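/- Fix $B>0$, $H>0$, $G_\infty\ge 0$ and let $\mathcal D=\{x\in\mathbb R^d:\|x\|_\infty\le B\}$. In rounds $t=1,\dots,n$ a learner plays $x_t$, then a loss $f_t:\mathbb R^d\to\mathbb R$ is revealed, and the learner suffers $f_t(x_t)$. Assume that each $f_t$ is $H$-strongly convex on $\mathcal D$, i.e. $$f_t(y)\ \ge\ f_t(x)+\nabla f_t(x)^{T}(y-x)+\tfrac H2\|y-x\|_2^2\qquad\text{for all }x,y\in\mathcal D,$$ and that $\|\nabla f_t(x)\|_\infty\le G_\infty$ for all $x\in\mathcal D$. Here $\nabla f_t(x)$ is the gradient or, where $f_t$ is not differentiable, any selection of subgradients for which these two conditions hold. **The learner.** For each coordinate $i\in[d]$ run one univariate FLH-OGD instance; instance $i$ plays $x_t[i]$ in round $t$ and then suffers the surrogate loss $$\ell_t^{(i)}(x)=\Bigl(x-\bigl(x_t[i]-\nabla f_t(x_t)[i]/H\bigr)\Bigr)^2 .$$ An FLH-OGD instance with decision set $[-B,B]$, learning rate $\zeta=1/(2(2B+G_\infty/H)^2)$ and losses $\ell_1,\ell_2,\dots$ is the following procedure. * For every $j\ge 1$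 the base learner $E^j$ starts in round $j$ at an arbitrary point $z_j^{(j)}\in[-B,B]$ and performs projected online gradient descent, with step size $1/(2k)$ in its $k$-th round: $z_{t+1}^{(j)}=\Pi_{[-B,B]}\bigl(z_t^{(j)}-\tfrac{1}{2(t-j+1)}\ell_t'(z_t^{(j)})\bigr)$ for $t\ge j$. * In round $t$ the instance holds a probability vector $(v_t^{(1)},\dots,v_t^{(t)})$, with $v_1^{(1)}=1$, and plays $\sum_{j=1}^t v_t^{(j)}z_t^{(j)}$. After $\ell_t$ is revealed, it sets $v_{t+1}^{(t+1)}=\tfrac1{t+1}$ and, for $j\le t$, $$v_{t+1}^{(j)}=\Bigl(1-\tfrac1{t+1}\Bigr)\frac{v_t^{(j)}e^{-\zeta\ell_t(z_t^{(j)})}}{\sum_{k=1}^t v_t^{(k)}e^{-\zeta\ell_t(z_t^{(k)})}} .$$ **Claim.** The learner is proper: $x_t\in\mathcal D$ for all $t\in[n]$. Moreover there are an absolute constant $p\in\mathbb N$ and a constant $K>0$ that depends only on $B,H,G_\infty$ (not on $d$, $n$, the losses, the initial points, the comparators or $C_n$) such that $$\sum_{t=1}^n\bigl(f_t(x_t)-f_t(w_t)\bigr)\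 \le\ K\,(1+\log n)^p\,\max\bigl\{d^{1/3}n^{1/3}C_n^{2/3},\ d\bigr\}$$ simultaneously for all $C_n\ge 0$ and all comparator sequences $w_1,\dots,w_n\in\mathcal D$ with $\sum_{t=2}^n\|w_t-w_{t-1}\|_1\le C_n$. That is, the dynamic regret is $\tilde O(d^{1/3}n^{1/3}C_n^{2/3}\vee d)$. -/

import Mathlib

noncomputable section

/-- Euclidean projection of the real line onto the interval `[-B, B]`. -/
def clip (B x : ℝ) : ℝ := max (-B) (min B x)

/-- The box `{x : ‖x‖_∞ ≤ B}` in `ℝ^d`. -/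
def box (d : ℕ) (B : ℝ) : Set (EuclideanSpace ℝ (Fin d)) := {x | ∀ i, |x i| ≤ B}

/-- State of a univariate FLH-OGD instance at the beginning of a round `t ≥ 1`.
`pred j` is the current prediction of the base learner `E^j` (the one started in round `j`) and
`wt j` is its FLH weight. Only the indices `1 ≤ j ≤ t` matter in round `t`. -/
structure FLHState where
  pred : ℕ → ℝ
  wt : ℕ → ℝ

/-- State at the beginning of round `1`; `x₀ j` is the initial point of the base learner `E^j`. -/
def FLHState.init (x₀ : ℕ → ℝ) : FLHState where
  pred := x₀
  wt := fun j => if j = 1 then 1 else 0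

/-- The point played in round `t`: the weighted average of the predictions of `E^1, …, E^t`. -/
def FLHState.play (s : FLHState) (t : ℕ) : ℝ :=
  ∑ j ∈ Finset.Icc 1 t, s.wt j * s.pred j

/-- FLH weight of `E^i` after the multiplicative update for the loss `ℓ` of round `t`. -/
def FLHState.hatWt (s : FLHState) (ζ : ℝ) (t : ℕ) (ℓ : ℝ → ℝ) (i : ℕ) : ℝ :=
  s.wt i * Real.exp (-ζ * ℓ (s.pred i)) /
    ∑ j ∈ Finset.Icc 1 t, s.wt j * Real.exp (-ζ * ℓ (s.pred j))

/-- Passage from round `t` to round `t + 1` after the loss `ℓ` is revealed.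
Each running base learner `E^j`, `1 ≤ j ≤ t`, is in its own round number `t - j + 1` and makes a
projected gradient step with step size `1 / (2 (t - j + 1))` on `[-B, B]`; base learners that have
not started yet stay at their initial point. The weights get the multiplicative update,
followed by the addition of `E^{t+1}` with weight `1 / (t + 1)`. -/
def FLHState.update (s : FLHState) (ζ B : ℝ) (t : ℕ) (ℓ : ℝ → ℝ) : FLHState where
  pred := fun j =>
    if j ≤ t then clip B (s.pred j - 1 / (2 * ((t : ℝ) - (j : ℝ) + 1)) * deriv ℓ (s.pred j))
    else s.pred j
  wt := fun j =>
    if j = t + 1 then 1 / ((t : ℝ) + 1)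
    else if j ≤ t then (1 - 1 / ((t : ℝ) + 1)) * s.hatWt ζ t ℓ j
    else 0

/-- The surrogate loss `x ↦ (x - (a - b / H))²`, where `a` is a coordinate of the played point
and `b` the same coordinate of the revealed gradient. -/
def surrogateLoss (H a b : ℝ) : ℝ → ℝ := fun x => (x - (a - b / H)) ^ 2

/-- The learning rate `1 / (2 (2B + G / H)²)`. -/
def flhRate (B H G : ℝ) : ℝ := 1 / (2 * (2 * B + G / H) ^ 2)

/-- The vector played in round `t` when coordinate `i` is predicted by the instance `s i`. -/
def playVec {d : ℕ} (s : Fin d → FLHState) (t : ℕ) : EuclideanSpace ℝ (Fin d) :=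
  WithLp.toLp 2 fun i => (s i).play t

/-- States of the `d` FLH-OGD instances after `k` rounds, i.e. at the beginning of round `k + 1`.
In round `t` the gradient feedback is `g t x`, where `x` is the point played in that round. -/
def learnerState {d : ℕ} (B H G : ℝ) (x₀ : Fin d → ℕ → ℝ)
    (g : ℕ → EuclideanSpace ℝ (Fin d) → EuclideanSpace ℝ (Fin d)) : ℕ → Fin d → FLHState
  | 0 => fun i => FLHState.init (x₀ i)
  | k + 1 => fun i =>
      let s := learnerState B H G x₀ g k
      let x := playVec s (k + 1)
      (s i).update (flhRate B H G) B (k + 1) (surrogateLoss H (x i) (g (k + 1) x i))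

/-- The prediction `x_t` of the coordinate-wise FLH-OGD learner in round `t ≥ 1`. -/
def learner {d : ℕ} (B H G : ℝ) (x₀ : Fin d → ℕ → ℝ)
    (g : ℕ → EuclideanSpace ℝ (Fin d) → EuclideanSpace ℝ (Fin d)) (t : ℕ) :
    EuclideanSpace ℝ (Fin d) :=
  playVec (learnerState B H G x₀ g (t - 1)) t

/-- The total variation `∑_{t=2}^n ‖w_t - w_{t-1}‖₁`. -/
def totalVariation {d : ℕ} (n : ℕ) (w : ℕ → EuclideanSpace ℝ (Fin d)) : ℝ :=
  ∑ t ∈ Finset.Icc 2 n, ∑ i, |w t i - w (t - 1) i|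

end

/-!
The learner is proper because each instance plays a convex combination of points of `[-B, B]`.

*Reduction to one dimension.* Strong convexity at the played point `x` gives
`f x - f w ≤ (H / 2) ∑ i, (ℓ i (x i) - ℓ i (w i))` with the surrogate squared losses `ℓ i`
(`sub_le_surrogate`). Their minimizers `y` satisfy `|z - y| ≤ M := 2 B + G / H` on `[-B, B]`.

*Strong adaptivity.* The squared loss is exp-concave at the rate used, so FLH loses at most
`2 M² log (n + 1)` to the expert `E^a` on every interval starting at `a`, and gradient descent with
step sizes `1 / (2 k)` has logarithmic regret. Hence an instance has regret at most
`R = 3 M² (1 + log n)` against every constant on every interval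
(`IsFLHRun.adaptive_regret_le`), and at most `R` per constant piece against a piecewise constant
sequence (`sum_le_of_interval_bound`).

*A piecewise constant comparator.* Fix `ε > 0`, put `lam = R / ε`, and let `w` minimize
`∑ (w k - y k)² + lam * TV w` over the box. Round `w` by hysteresis: an anchor stays until `w` is
more than `ε` away, and then moves to the current value of `w`; anchors within `ε` of an end point
of `[-B, B]` are replaced by this end point. Call the result `u`. Since `w` is at an end point only
where `u` is, small moves of `w` in the direction `w - u` are feasible. Where `u` jumps, `w` has an
increment of the same sign, and the jump of `u` has size at least `ε`. First-order optimality of `w`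
in the direction `w - u` then says that replacing `w` by `u` increases the squared error by at most
`lam * TV w - lam * ε * (number of jumps) + O (n ε²)` (`exists_rounding_of_minimizer`).
As `lam * ε = R`, the jumps pay for the regret against `u`, and minimality of `w` bounds the regret
against an arbitrary comparator of variation `V` by `R V / ε + R + O (n ε²)`
(`dynamic_regret_of_adaptive_regret`). Neither the number of pieces of `u` nor the variation of `w`
has to be controlled.

*Summation.* With the same `ε = (C / (d n))^(1/3)` (or `ε = 1 / n` if `C = 0`) in all coordinates,
the bounds add up to `O (R) * max (d^(1/3) n^(1/3) C^(2/3)) d`.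
-/

section

open Filter Topology Finset

/-! ### Piecewise constant rounding of the penalized optimum -/

/-- The squared-error fit of `w` to the data `y` on the indices `k < n`, penalized by `lam` times
the total variation of `w`. -/
noncomputable def tvObjective (lam : ℝ) (n : ℕ) (y w : ℕ → ℝ) : ℝ :=
  ∑ k ∈ range n, (w k - y k) ^ 2 + lam * ∑ k ∈ range (n - 1), |w (k + 1) - w k|

lemma tvObjective_congr {lam : ℝ} {n : ℕ} {y v w : ℕ → ℝ} (h : ∀ k < n, v k = w k) :
    tvObjective lam n y v = tvObjective lam n y w := by
  unfold tvObjective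
  congr 1
  · refine sum_congr rfl fun k hk => ?_
    rw [h k (mem_range.1 hk)]
  · congr 1
    refine sum_congr rfl fun k hk => ?_
    have hk := mem_range.1 hk
    rw [h k (by omega), h (k + 1) (by omega)]

lemma exists_tvObjective_minimizer {B : ℝ} (hB : 0 ≤ B) (lam : ℝ) (n : ℕ) (y : ℕ → ℝ) :
    ∃ w : ℕ → ℝ, (∀ k, |w k| ≤ B) ∧
      ∀ v : ℕ → ℝ, (∀ k < n, |v k| ≤ B) → tvObjective lam n y w ≤ tvObjective lam n y v := by
  have hc : IsCompact (Set.univ.pi fun _ : ℕ => Set.Icc (-B) B) :=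
    isCompact_univ_pi fun _ => isCompact_Icc
  have hne : (Set.univ.pi fun _ : ℕ => Set.Icc (-B) B).Nonempty :=
    ⟨fun _ => 0, fun k _ => ⟨by linarith, hB⟩⟩
  have hcont : Continuous (tvObjective lam n y) := by
    unfold tvObjective
    fun_prop
  obtain ⟨w, hw, hmin⟩ := hc.exists_isMinOn hne hcont.continuousOn
  refine ⟨w, fun k => abs_le.2 (hw k (Set.mem_univ k)), fun v hv => ?_⟩
  have hmem : (fun k => if k < n then v k else 0) ∈
      Set.univ.pi fun _ : ℕ => Set.Icc (-B) B := by
    intro k _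
    by_cases hk : k < n
    · simpa [hk] using abs_le.1 (hv k hk)
    · simp [hk, hB]
  calc tvObjective lam n y w ≤ tvObjective lam n y fun k => if k < n then v k else 0 := hmin hmem
    _ = tvObjective lam n y v := tvObjective_congr fun k hk => by simp [hk]

/-- The hysteresis rounding of `w`: the anchor stays where it is as long as `w` is within `ε` of it,
and otherwise moves to the current value of `w`. -/
noncomputable def anchor (ε : ℝ) (w : ℕ → ℝ) : ℕ → ℝ
  | 0 => w 0
  | k + 1 => if |w (k + 1) - anchor ε w k| ≤ ε then anchor ε w k else w (k + 1)

/-- Points of `[-B, B]` within `ε` of an end point are moved to this end point. -/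
noncomputable def snap (B ε p : ℝ) : ℝ := if B - ε ≤ p then B else if p ≤ -B + ε then -B else p

lemma abs_sub_anchor_le {ε : ℝ} (hε : 0 ≤ ε) (w : ℕ → ℝ) (k : ℕ) :
    |w k - anchor ε w k| ≤ ε := by
  cases k with
  | zero => simpa [anchor] using hε
  | succ k =>
    rw [anchor]
    split_ifs with h
    · exact h
    · simpa using hε

lemma abs_anchor_le {B ε : ℝ} {w : ℕ → ℝ} (hw : ∀ k, |w k| ≤ B) (k : ℕ) :
    |anchor ε w k| ≤ B := by
  induction k with
  | zero => exact hw 0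
  | succ k ih =>
    rw [anchor]
    split_ifs with h
    · exact ih
    · exact hw _

lemma abs_snap_sub_le {B ε p : ℝ} (hε : 0 ≤ ε) (hp : |p| ≤ B) : |snap B ε p - p| ≤ ε := by
  have := abs_le.1 hp
  rw [abs_le]
  unfold snap
  split_ifs <;> constructor <;> linarith

lemma abs_snap_le {B ε p : ℝ} (hp : |p| ≤ B) : |snap B ε p| ≤ B := by
  have := abs_le.1 hp
  rw [abs_le]
  unfold snap
  split_ifs <;> constructor <;> linarith

/-- When the anchor jumps, `w` jumps in the same direction, and the snapped anchor moves by more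
than `ε` in this direction. -/
lemma snap_anchor_jump {B ε : ℝ} (hε : 0 < ε) {w : ℕ → ℝ} (hw : ∀ k, |w k| ≤ B)
    {k : ℕ} (hk : anchor ε w (k + 1) ≠ anchor ε w k) :
    (w k < w (k + 1) ∧ ε ≤ snap B ε (anchor ε w (k + 1)) - snap B ε (anchor ε w k)) ∨
    (w (k + 1) < w k ∧ ε ≤ snap B ε (anchor ε w k) - snap B ε (anchor ε w (k + 1))) := by
  have h1 := abs_le.1 (abs_sub_anchor_le hε.le w k)
  have h2 := abs_le.1 (abs_anchor_le (ε := ε) hw k)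
  have h3 := abs_le.1 (hw (k + 1))
  rw [anchor] at hk ⊢
  split_ifs at hk ⊢ with h
  · exact absurd rfl hk
  · rw [not_le, lt_abs] at h
    rcases h with h | h
    · left
      refine ⟨by linarith, ?_⟩
      unfold snap
      split_ifs <;> linarith
    · right
      refine ⟨by linarith, ?_⟩
      unfold snap
      split_ifs <;> linarith

/-- Moving `w` away from its rounding by a small amount stays inside the box: where `w` is at an
end point of `[-B, B]`, its rounding is there as well. -/
lemma eventually_abs_extrapolation_le {B ε : ℝ} (hε : 0 < ε) (hεB : ε < B) {w : ℕ → ℝ}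
    (hw : ∀ k, |w k| ≤ B) (k : ℕ) :
    ∀ᶠ θ in 𝓝[>] (0 : ℝ), |w k + θ * (w k - snap B ε (anchor ε w k))| ≤ B := by
  have h1 := abs_le.1 (abs_sub_anchor_le hε.le w k)
  rcases (hw k).lt_or_eq with h | h
  · have ht : Tendsto (fun θ : ℝ => |w k + θ * (w k - snap B ε (anchor ε w k))|) (𝓝[>] 0)
        (𝓝 |w k + 0 * (w k - snap B ε (anchor ε w k))|) :=
      (Continuous.tendsto (by fun_prop) 0).mono_left nhdsWithin_le_nhds
    simp only [zero_mul, add_zero] at ht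
    exact (ht.eventually (gt_mem_nhds h)).mono fun _ h => le_of_lt h
  · have hs : snap B ε (anchor ε w k) = w k := by
      unfold snap
      rcases (abs_eq (hε.trans hεB).le).1 h with h | h
      · rw [if_pos (by linarith), h]
      · rw [if_neg (by linarith), if_pos (by linarith), h]
    exact Eventually.of_forall fun θ => by simp [hs, h]

/-- Moving `w` away from its rounding `u` scales its increments, except where `u` jumps: there the
increment of `u` has the sign of that of `w` and size at least `ε`. -/
lemma eventually_abs_increment_le {B ε : ℝ} (hε : 0 < ε) {w : ℕ → ℝ}
    (hw : ∀ k, |w k| ≤ B) {u : ℕ → ℝ} (hu : ∀ k, u k = snap B ε (anchor ε w k)) (k : ℕ) :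
    ∀ᶠ θ in 𝓝[>] (0 : ℝ),
      |(w (k + 1) + θ * (w (k + 1) - u (k + 1))) - (w k + θ * (w k - u k))| ≤
        (1 + θ) * |w (k + 1) - w k| - θ * (if u (k + 1) ≠ u k then ε else 0) := by
  by_cases hk : u (k + 1) = u k
  · filter_upwards [self_mem_nhdsWithin] with θ hθ
    have hθ : 0 < θ := hθ
    rw [hk, if_neg (by simp)]
    have : w (k + 1) + θ * (w (k + 1) - u k) - (w k + θ * (w k - u k)) =
        (1 + θ) * (w (k + 1) - w k) := by ring
    rw [this, abs_mul, abs_of_pos (by linarith : 0 < 1 + θ)]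
    simp
  · rw [if_pos hk]
    have ht : Tendsto (fun θ : ℝ =>
        (w (k + 1) + θ * (w (k + 1) - u (k + 1))) - (w k + θ * (w k - u k))) (𝓝[>] 0)
        (𝓝 ((w (k + 1) + 0 * (w (k + 1) - u (k + 1))) - (w k + 0 * (w k - u k)))) :=
      (Continuous.tendsto (by fun_prop) 0).mono_left nhdsWithin_le_nhds
    simp only [zero_mul, add_zero] at ht
    have hk' : anchor ε w (k + 1) ≠ anchor ε w k := fun h => hk (by rw [hu, hu, h])
    rcases snap_anchor_jump hε hw hk' with ⟨h1, h2⟩ | ⟨h1, h2⟩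
    · rw [← hu, ← hu] at h2
      filter_upwards [self_mem_nhdsWithin, ht.eventually (lt_mem_nhds (sub_pos.2 h1))]
        with θ hθ hpos
      have hθ : 0 < θ := hθ
      rw [abs_of_pos hpos, abs_of_pos (sub_pos.2 h1)]
      nlinarith
    · rw [← hu, ← hu] at h2
      filter_upwards [self_mem_nhdsWithin, ht.eventually (gt_mem_nhds (sub_neg.2 h1))]
        with θ hθ hneg
      have hθ : 0 < θ := hθ
      rw [abs_of_neg hneg, abs_of_neg (sub_neg.2 h1)]
      nlinarith

/-- Some piecewise constant sequence has squared error at most the optimal penalized objective, up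
to `8 n ε²`, minus `lam * ε` for each of its jumps. The proof rounds the optimum and moves the
optimum slightly away from its rounding. -/
lemma exists_rounding_of_minimizer {B ε lam : ℝ} (hε : 0 < ε) (hεB : ε < B) (hlam : 0 ≤ lam)
    {n : ℕ} {y w : ℕ → ℝ} (hw : ∀ k, |w k| ≤ B)
    (hmin : ∀ v : ℕ → ℝ, (∀ k < n, |v k| ≤ B) → tvObjective lam n y w ≤ tvObjective lam n y v) :
    ∃ u : ℕ → ℝ, (∀ k, |u k| ≤ B) ∧
      ∑ k ∈ range n, (u k - y k) ^ 2 + lam * ∑ k ∈ range (n - 1), (if u (k + 1) ≠ u k then ε else 0)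
        ≤ tvObjective lam n y w + 8 * n * ε ^ 2 := by
  set u : ℕ → ℝ := fun k => snap B ε (anchor ε w k) with hu
  refine ⟨u, fun k => abs_snap_le (abs_anchor_le hw k), ?_⟩
  have hdist : ∀ k, (u k - w k) ^ 2 ≤ 4 * ε ^ 2 := by
    intro k
    have h1 := abs_le.1 (abs_sub_anchor_le hε.le w k)
    have h2 := abs_le.1 (abs_snap_sub_le hε.le (abs_anchor_le (ε := ε) hw k))
    have : |u k - w k| ≤ |2 * ε| := by
      rw [abs_of_pos (by linarith : 0 < 2 * ε), abs_le]
      simp only [hu]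
      constructor <;> linarith
    calc (u k - w k) ^ 2 ≤ (2 * ε) ^ 2 := sq_le_sq.2 this
      _ = 4 * ε ^ 2 := by ring
  have hev1 : ∀ᶠ θ in 𝓝[>] (0 : ℝ), ∀ k ∈ range n, |w k + θ * (w k - u k)| ≤ B :=
    (eventually_all_finset _).2 fun k _ => eventually_abs_extrapolation_le hε hεB hw k
  have hev2 := (eventually_all_finset (range (n - 1))).2 fun k _ =>
    eventually_abs_increment_le hε hw (u := u) (fun _ => rfl) k
  have hev3 : ∀ᶠ θ in 𝓝[>] (0 : ℝ), θ < 1 :=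
    nhdsWithin_le_nhds (gt_mem_nhds one_pos)
  -- a single `θ < 1` suffices: the second-order term `θ * Q` goes into the error
  obtain ⟨θ, hθ1, hbox, htv, hθ⟩ :=
    (hev3.and (hev1.and (hev2.and self_mem_nhdsWithin))).exists
  have hθ : 0 < θ := hθ
  have hF := hmin (fun k => w k + θ * (w k - u k)) fun k hk => hbox k (mem_range.2 hk)
  set J := ∑ k ∈ range (n - 1), (if u (k + 1) ≠ u k then ε else 0) with hJ
  set TV := ∑ k ∈ range (n - 1), |w (k + 1) - w k| with hTV
  have htv' := sum_le_sum htv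
  rw [sum_sub_distrib, ← mul_sum, ← mul_sum, ← hJ, ← hTV] at htv'
  set S := ∑ k ∈ range n, (w k - u k) * (w k - y k) with hS
  set Q := ∑ k ∈ range n, (u k - w k) ^ 2 with hQ
  have hQle : Q ≤ n * (4 * ε ^ 2) := by
    simpa using sum_le_card_nsmul (range n) _ _ fun k _ => hdist k
  have hQ0 : 0 ≤ Q := sum_nonneg fun k _ => sq_nonneg _
  have e1 : ∑ k ∈ range n, (w k + θ * (w k - u k) - y k) ^ 2 =
      ∑ k ∈ range n, (w k - y k) ^ 2 + 2 * θ * S + θ ^ 2 * Q := by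
    rw [hS, hQ, mul_sum, mul_sum, ← sum_add_distrib, ← sum_add_distrib]
    exact sum_congr rfl fun k _ => by ring
  have e2 : ∑ k ∈ range n, (u k - y k) ^ 2 = ∑ k ∈ range n, (w k - y k) ^ 2 - 2 * S + Q := by
    rw [hS, hQ, mul_sum, ← sum_sub_distrib, ← sum_add_distrib]
    exact sum_congr rfl fun k _ => by ring
  unfold tvObjective at hF ⊢
  rw [e1] at hF
  rw [e2]
  have h1 := mul_le_mul_of_nonneg_left htv' hlam
  have h2 : 0 ≤ θ * (2 * S + θ * Q + lam * (TV - J)) := by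
    linarith
  have h3 : 0 ≤ 2 * S + θ * Q + lam * (TV - J) := nonneg_of_mul_nonneg_right h2 hθ
  have h4 : θ * Q ≤ Q := mul_le_of_le_one_left hQ0 hθ1.le
  linarith

/-! ### From adaptive regret to dynamic regret -/

/-- If the regret against constants is at most `R` on every interval, then the regret against a
sequence `u` is at most `R` times its number of constant pieces. -/
lemma sum_le_of_interval_bound {n : ℕ} {P : ℝ → Prop} {R : ℝ} {L : ℕ → ℝ → ℝ}
    (had : ∀ a b u, a ≤ b → b ≤ n → P u → ∑ k ∈ Ico a b, L k u ≤ R)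
    (hR : 0 ≤ R) {u : ℕ → ℝ} (hu : ∀ k, P (u k)) :
    ∑ k ∈ range n, L k (u k) ≤
      R * (1 + ∑ k ∈ range (n - 1), (if u (k + 1) ≠ u k then (1 : ℝ) else 0)) := by
  -- `a` is the beginning of the last constant piece of `u` on `[0, m]`
  have key : ∀ m < n, ∃ a ≤ m, (∀ k ∈ Ico a (m + 1), u k = u m) ∧
      ∑ k ∈ range a, L k (u k) ≤
        R * ∑ k ∈ range m, (if u (k + 1) ≠ u k then (1 : ℝ) else 0) := by
    intro m
    induction m with
    | zero => exact fun _ => ⟨0, le_rfl, by simp, by simp⟩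
    | succ m ih =>
      intro hm
      obtain ⟨a, ha, hconst, hsum⟩ := ih (by omega)
      by_cases h : u (m + 1) = u m
      · refine ⟨a, by omega, fun k hk => ?_, by simpa [sum_range_succ, h] using hsum⟩
        rw [mem_Ico] at hk
        rcases Nat.lt_or_ge k (m + 1) with hk' | hk'
        · rw [h]
          exact hconst k (mem_Ico.2 ⟨hk.1, hk'⟩)
        · rw [show k = m + 1 by omega]
      · refine ⟨m + 1, le_rfl, by simp, ?_⟩
        rw [← sum_range_add_sum_Ico _ (by omega : a ≤ m + 1), sum_range_succ _ m, if_pos h]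
        have h1 : ∑ k ∈ Ico a (m + 1), L k (u k) ≤ R := by
          rw [sum_congr rfl fun k hk => by rw [hconst k hk]]
          exact had a (m + 1) (u m) (by omega) (by omega) (hu m)
        linarith
  rcases n with _ | m
  · simpa using hR
  · obtain ⟨a, ha, hconst, hsum⟩ := key m (by omega)
    have h1 : ∑ k ∈ Ico a (m + 1), L k (u k) ≤ R := by
      rw [sum_congr rfl fun k hk => by rw [hconst k hk]]
      exact had a (m + 1) (u m) (by omega) le_rfl (hu m)
    rw [← sum_range_add_sum_Ico _ (by omega : a ≤ m + 1), Nat.add_sub_cancel]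
    linarith

/-- Dynamic regret of a univariate learner with regret at most `R` against constants on every
interval, for every resolution `ε` of the rounding. -/
lemma dynamic_regret_of_adaptive_regret {B M R ε : ℝ} (hB : 0 < B) (hR : 0 ≤ R) (hε : 0 < ε)
    {n : ℕ} {x y : ℕ → ℝ} (hM : ∀ k < n, |x k - y k| ≤ M)
    (had : ∀ a b u, a ≤ b → b ≤ n → |u| ≤ B →
      ∑ k ∈ Ico a b, ((x k - y k) ^ 2 - (u - y k) ^ 2) ≤ R)
    {w : ℕ → ℝ} (hw : ∀ k < n, |w k| ≤ B) :
    ∑ k ∈ range n, ((x k - y k) ^ 2 - (w k - y k) ^ 2) ≤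
      R / ε * (∑ k ∈ range (n - 1), |w (k + 1) - w k|) + R + (8 + M ^ 2 / B ^ 2) * n * ε ^ 2 := by
  have hTV : 0 ≤ ∑ k ∈ range (n - 1), |w (k + 1) - w k| := sum_nonneg fun k _ => abs_nonneg _
  have hRε : 0 ≤ R / ε := div_nonneg hR hε.le
  have hn : (0 : ℝ) ≤ n := Nat.cast_nonneg n
  rcases lt_or_ge ε B with hεB | hεB
  · obtain ⟨v, hv, hmin⟩ := exists_tvObjective_minimizer hB.le (R / ε) n y
    obtain ⟨u, hu, hround⟩ := exists_rounding_of_minimizer hε hεB hRε hv hmin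
    have h1 := sum_le_of_interval_bound had hR (u := u) hu
    have h2 := hmin w hw
    have h3 : R / ε * ∑ k ∈ range (n - 1), (if u (k + 1) ≠ u k then ε else 0) =
        R * ∑ k ∈ range (n - 1), (if u (k + 1) ≠ u k then (1 : ℝ) else 0) := by
      rw [mul_sum, mul_sum]
      refine sum_congr rfl fun k _ => ?_
      split_ifs
      · field_simp
      · simp
    have h4 : tvObjective (R / ε) n y w = ∑ k ∈ range n, (w k - y k) ^ 2 +
      R / ε * ∑ k ∈ range (n - 1), |w (k + 1) - w k| := rfl
    have h5 : 0 ≤ M ^ 2 / B ^ 2 * n * ε ^ 2 := by positivity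
    rw [sum_sub_distrib] at h1 ⊢
    linarith
  · -- for `ε ≥ B` the last term alone exceeds the trivial bound `n M²`
    have h1 : ∑ k ∈ range n, ((x k - y k) ^ 2 - (w k - y k) ^ 2) ≤ n * M ^ 2 := by
      have : ∀ k ∈ range n, (x k - y k) ^ 2 - (w k - y k) ^ 2 ≤ M ^ 2 := fun k hk => by
        have := sq_le_sq' (abs_le.1 (hM k (mem_range.1 hk))).1 (abs_le.1 (hM k (mem_range.1 hk))).2
        linarith [sq_nonneg (w k - y k)]
      simpa using sum_le_card_nsmul (range n) _ _ this
    have h2 : M ^ 2 ≤ M ^ 2 / B ^ 2 * ε ^ 2 := by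
      rw [div_mul_eq_mul_div, le_div_iff₀ (by positivity)]
      gcongr
    have h3 : n * M ^ 2 ≤ n * (M ^ 2 / B ^ 2 * ε ^ 2) := by gcongr
    have h4 : 0 ≤ R / ε * ∑ k ∈ range (n - 1), |w (k + 1) - w k| := mul_nonneg hRε hTV
    have h5 : 0 ≤ 8 * n * ε ^ 2 := by positivity
    linarith

/-! ### A univariate FLH-OGD instance with squared losses -/

lemma abs_clip_le {B : ℝ} (hB : 0 ≤ B) (x : ℝ) : |clip B x| ≤ B := by
  rw [abs_le]
  exact ⟨le_max_left _ _, max_le (by linarith) (min_le_left _ _)⟩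

/-- Projecting onto `[-B, B]` does not increase the distance to a point of `[-B, B]`. -/
lemma sq_clip_sub_le {B u : ℝ} (hu : |u| ≤ B) (x : ℝ) : (clip B x - u) ^ 2 ≤ (x - u) ^ 2 := by
  have hu := abs_le.1 hu
  unfold clip
  rcases le_total B x with h | h
  · rw [min_eq_left h, max_eq_right (by linarith)]
    exact sq_le_sq' (by linarith) (by linarith)
  · rw [min_eq_right h]
    rcases le_total x (-B) with h' | h'
    · rw [max_eq_left h', ← neg_sq, ← neg_sq (x - u)]
      exact sq_le_sq' (by linarith) (by linarith)
    · rw [max_eq_right h']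

lemma deriv_sq_sub (c x : ℝ) : deriv (fun z : ℝ => (z - c) ^ 2) x = 2 * (x - c) := by
  have h : HasDerivAt (fun z : ℝ => (z - c) ^ 2) (2 * (x - c)) x := by
    simpa using ((hasDerivAt_id' x).sub_const c).fun_pow 2
  exact h.deriv

/-- Exp-concavity of the squared loss. -/
lemma concaveOn_exp_neg_sq {ζ M c : ℝ} (hζ : 0 ≤ ζ) (hM : 2 * ζ * M ^ 2 ≤ 1) :
    ConcaveOn ℝ (Set.Icc (c - M) (c + M)) fun x : ℝ => Real.exp (-ζ * (x - c) ^ 2) := by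
  have h1 : ∀ x : ℝ, HasDerivAt (fun x : ℝ => Real.exp (-ζ * (x - c) ^ 2))
      (Real.exp (-ζ * (x - c) ^ 2) * (-2 * ζ * (x - c))) x := by
    intro x
    have h : HasDerivAt (fun x : ℝ => -ζ * (x - c) ^ 2) (-2 * ζ * (x - c)) x := by
      refine ((((hasDerivAt_id' x).sub_const c).fun_pow 2).const_mul (-ζ)).congr_deriv ?_
      push_cast
      ring
    exact h.exp
  have h2 : ∀ x : ℝ, HasDerivAt (fun x : ℝ => Real.exp (-ζ * (x - c) ^ 2) * (-2 * ζ * (x - c)))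
      (Real.exp (-ζ * (x - c) ^ 2) * (2 * ζ * (2 * ζ * (x - c) ^ 2 - 1))) x := by
    intro x
    have h : HasDerivAt (fun x : ℝ => -2 * ζ * (x - c)) (-2 * ζ) x := by
      simpa using ((hasDerivAt_id' x).sub_const c).const_mul (-2 * ζ)
    refine ((h1 x).fun_mul h).congr_deriv ?_
    ring
  refine concaveOn_of_hasDerivWithinAt2_nonpos (convex_Icc _ _)
    (Continuous.continuousOn (by fun_prop)) (fun x _ => (h1 x).hasDerivWithinAt)
    (fun x _ => (h2 x).hasDerivWithinAt) fun x hx => ?_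
  rw [interior_Icc] at hx
  have h3 : (x - c) ^ 2 ≤ M ^ 2 := sq_le_sq' (by linarith [hx.1]) (by linarith [hx.2])
  have h4 : 2 * ζ * (x - c) ^ 2 ≤ 2 * ζ * M ^ 2 := by gcongr
  exact mul_nonpos_of_nonneg_of_nonpos (Real.exp_nonneg _)
    (mul_nonpos_of_nonneg_of_nonpos (by positivity) (by linarith))

/-- The sequence `s` of states is a run of FLH-OGD with initial points `z₀` and the losses
`x ↦ (x - y k)²`. The index `k` starts at `0`, so `s k` and `y k` belong to round `k + 1`. -/
structure IsFLHRun (ζ B : ℝ) (z₀ : ℕ → ℝ) (y : ℕ → ℝ) (s : ℕ → FLHState) : Prop where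
  zero : s 0 = FLHState.init z₀
  succ : ∀ k, s (k + 1) = (s k).update ζ B (k + 1) fun x => (x - y k) ^ 2

namespace IsFLHRun

variable {ζ B : ℝ} {z₀ y : ℕ → ℝ} {s : ℕ → FLHState}

lemma abs_pred_le (h : IsFLHRun ζ B z₀ y s) (hB : 0 ≤ B) (hz : ∀ j, |z₀ j| ≤ B) (k j : ℕ) :
    |(s k).pred j| ≤ B := by
  induction k with
  | zero => simpa [h.zero, FLHState.init] using hz j
  | succ k ih =>
    rw [h.succ]
    dsimp only [FLHState.update]
    split_ifs
    · exact abs_clip_le hB _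
    · exact ih

lemma wt_succ (h : IsFLHRun ζ B z₀ y s) {k j : ℕ} (hj : j ≤ k + 1) :
    (s (k + 1)).wt j = (k + 1) / (k + 2) *
      ((s k).wt j * Real.exp (-ζ * ((s k).pred j - y k) ^ 2) /
        ∑ j ∈ Icc 1 (k + 1), (s k).wt j * Real.exp (-ζ * ((s k).pred j - y k) ^ 2)) := by
  have hc : (1 : ℝ) - 1 / (((k + 1 : ℕ) : ℝ) + 1) = (k + 1) / (k + 2) := by
    push_cast
    field_simp
    ring
  rw [h.succ]
  dsimp only [FLHState.update, FLHState.hatWt]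
  rw [if_neg (by omega), if_pos hj, hc]

lemma wt_pos_and_sum (h : IsFLHRun ζ B z₀ y s) (k : ℕ) :
    (∀ j ∈ Icc 1 (k + 1), 0 < (s k).wt j) ∧ ∑ j ∈ Icc 1 (k + 1), (s k).wt j = 1 := by
  induction k with
  | zero => simp [h.zero, FLHState.init]
  | succ k ih =>
    have hZ : 0 < ∑ j ∈ Icc 1 (k + 1),
        (s k).wt j * Real.exp (-ζ * ((s k).pred j - y k) ^ 2) :=
      sum_pos (fun j hj => mul_pos (ih.1 j hj) (Real.exp_pos _)) ⟨1, by simp⟩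
    have hk : (0 : ℝ) < k + 1 := by positivity
    have hwt := fun j (hj : j ∈ Icc 1 (k + 1)) => h.wt_succ (mem_Icc.1 hj).2
    have hlast : (s (k + 1)).wt (k + 1 + 1) = 1 / (k + 2) := by
      rw [h.succ]
      dsimp only [FLHState.update]
      rw [if_pos rfl]
      push_cast
      ring
    constructor
    · intro j hj
      rw [mem_Icc] at hj
      rcases Nat.lt_or_ge j (k + 2) with hj' | hj'
      · have hm : j ∈ Icc 1 (k + 1) := mem_Icc.2 ⟨hj.1, by omega⟩
        rw [hwt j hm]
        have := ih.1 j hm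
        positivity
      · rw [show j = k + 1 + 1 by omega, hlast]
        positivity
    · rw [sum_Icc_succ_top (by omega), hlast, sum_congr rfl hwt, ← mul_sum, ← sum_div,
        div_self hZ.ne']
      field_simp
      ring

lemma wt_start (h : IsFLHRun ζ B z₀ y s) (a : ℕ) : (s a).wt (a + 1) = 1 / (a + 1) := by
  cases a with
  | zero => simp [h.zero, FLHState.init]
  | succ a =>
    rw [h.succ]
    simp [FLHState.update]

lemma abs_play_le (h : IsFLHRun ζ B z₀ y s) (hB : 0 ≤ B) (hz : ∀ j, |z₀ j| ≤ B) (k : ℕ) :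
    |(s k).play (k + 1)| ≤ B := by
  obtain ⟨hpos, hsum⟩ := h.wt_pos_and_sum k
  calc |(s k).play (k + 1)| ≤ ∑ j ∈ Icc 1 (k + 1), |(s k).wt j * (s k).pred j| :=
        abs_sum_le_sum_abs _ _
    _ ≤ ∑ j ∈ Icc 1 (k + 1), (s k).wt j * B := by
        refine sum_le_sum fun j hj => ?_
        rw [abs_mul, abs_of_pos (hpos j hj)]
        exact mul_le_mul_of_nonneg_left (h.abs_pred_le hB hz k j) (hpos j hj).le
    _ = B := by rw [← sum_mul, hsum, one_mul]

/-- One round of FLH against the expert `j`: exp-concavity turns the loss of the weighted average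
into the logarithm of the normalizing constant of the weight update. -/
lemma loss_sub_le (h : IsFLHRun ζ B z₀ y s) (hB : 0 ≤ B) (hz : ∀ j, |z₀ j| ≤ B) {M : ℝ}
    (hζ : 0 ≤ ζ) (hM : 2 * ζ * M ^ 2 ≤ 1) {k j : ℕ} (hk : ∀ x, |x| ≤ B → |x - y k| ≤ M)
    (hj : j ∈ Icc 1 (k + 1)) :
    ζ * (((s k).play (k + 1) - y k) ^ 2 - ((s k).pred j - y k) ^ 2) ≤
      Real.log ((s (k + 1)).wt j) - Real.log ((s k).wt j) +
        (Real.log (k + 2) - Real.log (k + 1)) := by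
  obtain ⟨hpos, hsum⟩ := h.wt_pos_and_sum k
  have hconc := (concaveOn_exp_neg_sq (c := y k) hζ hM).le_map_sum
    (t := Icc 1 (k + 1)) (w := (s k).wt) (p := (s k).pred) (fun j hj => (hpos j hj).le) hsum
    fun j _ => by
      have := abs_le.1 (hk _ (h.abs_pred_le hB hz k j))
      exact ⟨by linarith, by linarith⟩
  simp only [smul_eq_mul] at hconc
  have hw := h.wt_succ (mem_Icc.1 hj).2
  set Z := ∑ j ∈ Icc 1 (k + 1), (s k).wt j * Real.exp (-ζ * ((s k).pred j - y k) ^ 2) with hZdef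
  have hZ : 0 < Z := sum_pos (fun j hj => mul_pos (hpos j hj) (Real.exp_pos _)) ⟨1, by simp⟩
  have hlog : Real.log Z ≤ -ζ * ((s k).play (k + 1) - y k) ^ 2 :=
    (Real.log_le_iff_le_exp hZ).2 hconc
  have hv := hpos j hj
  have hk1 : (0 : ℝ) < k + 1 := by positivity
  have hk2 : (0 : ℝ) < k + 2 := by positivity
  have he := Real.exp_pos (-ζ * ((s k).pred j - y k) ^ 2)
  rw [hw, Real.log_mul (by positivity) (by positivity), Real.log_div hk1.ne' hk2.ne',
    Real.log_div (by positivity) hZ.ne', Real.log_mul hv.ne' he.ne', Real.log_exp]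
  linarith

/-- FLH competes with the expert started in round `a + 1` on every interval starting there. -/
lemma regret_expert_le (h : IsFLHRun ζ B z₀ y s) (hB : 0 ≤ B) (hz : ∀ j, |z₀ j| ≤ B) {M : ℝ}
    (hζ : 0 ≤ ζ) (hM : 2 * ζ * M ^ 2 ≤ 1) {n : ℕ}
    (hy : ∀ k < n, ∀ x, |x| ≤ B → |x - y k| ≤ M) {a b : ℕ} (hab : a ≤ b) (hbn : b ≤ n) :
    ζ * ∑ k ∈ Ico a b, (((s k).play (k + 1) - y k) ^ 2 - ((s k).pred (a + 1) - y k) ^ 2) ≤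
      Real.log (b + 1) := by
  have key : ∀ b, a ≤ b → b ≤ n →
      ζ * ∑ k ∈ Ico a b, (((s k).play (k + 1) - y k) ^ 2 - ((s k).pred (a + 1) - y k) ^ 2) ≤
        Real.log ((s b).wt (a + 1)) + Real.log (b + 1) := by
    intro b hab
    induction b, hab using Nat.le_induction with
    | base =>
      intro _
      rw [h.wt_start, one_div, Real.log_inv]
      simp
    | succ b hab ih =>
      intro hb
      have h1 := ih (by omega)
      have h2 := h.loss_sub_le hB hz hζ hM (hy b (by omega))
        (mem_Icc.2 ⟨by omega, by omega⟩ : a + 1 ∈ Icc 1 (b + 1))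
      rw [sum_Ico_succ_top hab, mul_add]
      have e : ((b + 1 : ℕ) : ℝ) + 1 = b + 2 := by push_cast; ring
      rw [e]
      linarith
  have h1 := key b hab hbn
  obtain ⟨hpos, hsum⟩ := h.wt_pos_and_sum b
  have hm : a + 1 ∈ Icc 1 (b + 1) := mem_Icc.2 ⟨by omega, by omega⟩
  have h2 : (s b).wt (a + 1) ≤ 1 := hsum ▸ single_le_sum (fun j hj => (hpos j hj).le) hm
  have h3 := Real.log_nonpos (hpos _ hm).le h2
  linarith

/-- Projected online gradient descent on strongly convex losses has logarithmic regret: with step size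
`1 / (2 m)` the multiples `m (z - u)²` of the squared distances to the comparator telescope. -/
lemma regret_ogd_le (h : IsFLHRun ζ B z₀ y s) (hB : 0 ≤ B) (hz : ∀ j, |z₀ j| ≤ B) {M : ℝ}
    {n : ℕ} (hy : ∀ k < n, ∀ x, |x| ≤ B → |x - y k| ≤ M) {u : ℝ} (hu : |u| ≤ B) {a b : ℕ}
    (hab : a ≤ b) (hbn : b ≤ n) :
    ∑ k ∈ Ico a b, (((s k).pred (a + 1) - y k) ^ 2 - (u - y k) ^ 2) ≤
      M ^ 2 * (1 + Real.log n) := by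
  have key : ∀ b, a ≤ b → b ≤ n →
      ∑ k ∈ Ico a b, (((s k).pred (a + 1) - y k) ^ 2 - (u - y k) ^ 2) ≤
        M ^ 2 * (harmonic (b - a) : ℝ) - (b - a) * ((s b).pred (a + 1) - u) ^ 2 := by
    intro b hab
    induction b, hab using Nat.le_induction with
    | base => simp
    | succ b hab ih =>
      intro hb
      have h1 := ih (by omega)
      rw [sum_Ico_succ_top hab]
      set z := (s b).pred (a + 1) with hzdef
      obtain ⟨m, rfl⟩ := Nat.exists_eq_add_of_le hab
      have hnext : (s (a + m + 1)).pred (a + 1) =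
          clip B (z - 1 / (2 * ((m : ℝ) + 1)) * (2 * (z - y (a + m)))) := by
        rw [h.succ]
        dsimp only [FLHState.update]
        rw [if_pos (by omega), deriv_sq_sub, hzdef]
        congr 5
        push_cast
        ring
      have hproj := sq_clip_sub_le hu (z - 1 / (2 * ((m : ℝ) + 1)) * (2 * (z - y (a + m))))
      rw [← hnext] at hproj
      have hm : (0 : ℝ) < m + 1 := by positivity
      have hMz := hy (a + m) (by omega) z (h.abs_pred_le hB hz _ _)
      have hMz' := sq_le_sq' (abs_le.1 hMz).1 (abs_le.1 hMz).2
      have e1 : a + m - a = m := by omega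
      have e2 : a + m + 1 - a = m + 1 := by omega
      rw [e1] at h1
      rw [e2, harmonic_succ]
      push_cast at h1 ⊢
      have hexp : ((m : ℝ) + 1) * (z - 1 / (2 * ((m : ℝ) + 1)) * (2 * (z - y (a + m))) - u) ^ 2 =
          (m + 1) * (z - u) ^ 2 - 2 * (z - u) * (z - y (a + m)) +
            (z - y (a + m)) ^ 2 * ((m : ℝ) + 1)⁻¹ := by
        field_simp
        ring
      have h3 := mul_le_mul_of_nonneg_left hproj hm.le
      rw [hexp] at h3
      have h4 : (z - y (a + m)) ^ 2 * ((m : ℝ) + 1)⁻¹ ≤ M ^ 2 * ((m : ℝ) + 1)⁻¹ := by gcongr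
      linarith
  have h1 := key b hab hbn
  have hb : (0 : ℝ) ≤ b - a := sub_nonneg.2 (Nat.cast_le.2 hab)
  have h2 : (harmonic (b - a) : ℝ) ≤ 1 + Real.log n := by
    rcases Nat.eq_zero_or_pos (b - a) with h0 | h0
    · rw [h0]
      have := Real.log_natCast_nonneg n
      simp
      linarith
    · refine (harmonic_le_one_add_log _).trans ?_
      gcongr
      omega
  have h3 : 0 ≤ (b - a) * ((s b).pred (a + 1) - u) ^ 2 := mul_nonneg hb (sq_nonneg _)
  have h4 : M ^ 2 * (harmonic (b - a) : ℝ) ≤ M ^ 2 * (1 + Real.log n) := by gcongr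
  linarith

/-- Strong adaptivity: logarithmic regret against every constant on every interval. -/
lemma adaptive_regret_le (h : IsFLHRun ζ B z₀ y s) (hB : 0 ≤ B) (hz : ∀ j, |z₀ j| ≤ B) {M : ℝ}
    (hM : 0 < M) (hζ : ζ = 1 / (2 * M ^ 2)) {n : ℕ}
    (hy : ∀ k < n, ∀ x, |x| ≤ B → |x - y k| ≤ M) {u : ℝ} (hu : |u| ≤ B) {a b : ℕ}
    (hab : a ≤ b) (hbn : b ≤ n) :
    ∑ k ∈ Ico a b, (((s k).play (k + 1) - y k) ^ 2 - (u - y k) ^ 2) ≤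
      3 * M ^ 2 * (1 + Real.log n) := by
  have hζM : 2 * ζ * M ^ 2 = 1 := by
    rw [hζ]
    field_simp
  have h1 := h.regret_expert_le hB hz (by rw [hζ]; positivity) hζM.le hy hab hbn
  have h2 := h.regret_ogd_le hB hz hy hu hab hbn
  have h3 : Real.log (b + 1) ≤ 1 + Real.log n := by
    rcases Nat.eq_zero_or_pos n with h0 | h0
    · have hb0 : b = 0 := by omega
      simp [h0, hb0]
    · have hn : (1 : ℝ) ≤ n := Nat.one_le_cast.2 h0
      have hbn' : (b : ℝ) ≤ n := Nat.cast_le.2 hbn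
      calc Real.log (b + 1) ≤ Real.log (2 * n) :=
            Real.log_le_log (by positivity) (by linarith)
        _ = Real.log 2 + Real.log n := Real.log_mul two_ne_zero (by positivity)
        _ ≤ 1 + Real.log n := by linarith [Real.log_two_lt_d9]
  rw [sum_sub_distrib] at h1 h2 ⊢
  set S := ∑ k ∈ Ico a b, ((s k).play (k + 1) - y k) ^ 2
  set T := ∑ k ∈ Ico a b, ((s k).pred (a + 1) - y k) ^ 2
  have h4 : S - T ≤ 2 * M ^ 2 * (1 + Real.log n) := by
    calc S - T = 2 * M ^ 2 * (ζ * (S - T)) := by linear_combination -(S - T) * hζM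
      _ ≤ 2 * M ^ 2 * (1 + Real.log n) := by gcongr; exact h1.trans h3
  linarith

end IsFLHRun

/-! ### The coordinate-wise learner -/

section Learner

variable {d : ℕ} {B H G : ℝ} {x₀ : Fin d → ℕ → ℝ}
  {g : ℕ → EuclideanSpace ℝ (Fin d) → EuclideanSpace ℝ (Fin d)}

/-- The minimizer of the surrogate loss of round `k + 1` in coordinate `i`. -/
noncomputable def surrogateTarget (B H G : ℝ) (x₀ : Fin d → ℕ → ℝ)
    (g : ℕ → EuclideanSpace ℝ (Fin d) → EuclideanSpace ℝ (Fin d)) (i : Fin d) (k : ℕ) : ℝ :=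
  learner B H G x₀ g (k + 1) i - g (k + 1) (learner B H G x₀ g (k + 1)) i / H

lemma isFLHRun_learnerState (i : Fin d) :
    IsFLHRun (flhRate B H G) B (x₀ i) (surrogateTarget B H G x₀ g i)
      fun k => learnerState B H G x₀ g k i where
  zero := rfl
  succ _ := rfl

lemma learner_mem_box (hB : 0 ≤ B) (hx₀ : ∀ i j, |x₀ i j| ≤ B) (k : ℕ) :
    learner B H G x₀ g (k + 1) ∈ box d B :=
  fun i => (isFLHRun_learnerState (H := H) (G := G) (g := g) i).abs_play_le hB (hx₀ i) k

/-- Strong convexity bounds the regret in a round by the surrogate regrets of the coordinates. -/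
lemma sub_le_surrogate (hH : 0 < H) {f : EuclideanSpace ℝ (Fin d) → ℝ}
    {v x w : EuclideanSpace ℝ (Fin d)}
    (h : f x + inner ℝ v (w - x) + H / 2 * ‖w - x‖ ^ 2 ≤ f w) :
    f x - f w ≤ H / 2 * ∑ i, ((x i - (x i - v i / H)) ^ 2 - (w i - (x i - v i / H)) ^ 2) := by
  have e : H / 2 * ∑ i, ((x i - (x i - v i / H)) ^ 2 - (w i - (x i - v i / H)) ^ 2) =
      -(inner ℝ v (w - x) + H / 2 * ‖w - x‖ ^ 2) := by
    rw [EuclideanSpace.real_norm_sq_eq, PiLp.inner_apply, mul_sum, mul_sum, ← sum_add_distrib,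
      ← sum_neg_distrib]
    refine sum_congr rfl fun i _ => ?_
    simp only [PiLp.sub_apply, RCLike.inner_apply, conj_trivial]
    field_simp
    ring
  rw [e]
  linarith

lemma sum_Icc_succ_eq_sum_range (m n : ℕ) (F : ℕ → ℝ) :
    ∑ t ∈ Icc (m + 1) n, F t = ∑ k ∈ range (n - m), F (k + (m + 1)) :=
  sum_nbij' (· - (m + 1)) (· + (m + 1))
    (fun t ht => by simp only [mem_Icc, mem_range] at *; omega)
    (fun t ht => by simp only [mem_Icc, mem_range] at *; omega)
    (fun t ht => by simp only [mem_Icc] at *; omega)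
    (fun t ht => by simp)
    (fun t ht => by
      rw [mem_Icc] at ht
      rw [Nat.sub_add_cancel ht.1])

/-- The surrogate regret of coordinate `i`, for every resolution `ε` of the rounding. -/
lemma surrogate_regret_le (hB : 0 < B) (hH : 0 < H) (hG : 0 ≤ G) (hx₀ : ∀ i j, |x₀ i j| ≤ B)
    {n : ℕ} (hg : ∀ t ∈ Icc 1 n, ∀ x ∈ box d B, ∀ i, |g t x i| ≤ G) (i : Fin d) {w : ℕ → ℝ}
    (hw : ∀ k < n, |w k| ≤ B) {ε : ℝ} (hε : 0 < ε) :
    ∑ k ∈ range n, ((learner B H G x₀ g (k + 1) i - surrogateTarget B H G x₀ g i k) ^ 2 -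
        (w k - surrogateTarget B H G x₀ g i k) ^ 2) ≤
      3 * (2 * B + G / H) ^ 2 * (1 + Real.log n) / ε * (∑ k ∈ range (n - 1), |w (k + 1) - w k|) +
        3 * (2 * B + G / H) ^ 2 * (1 + Real.log n) +
        (8 + (2 * B + G / H) ^ 2 / B ^ 2) * n * ε ^ 2 := by
  have hM : 0 < 2 * B + G / H := by positivity
  have hlog : 0 ≤ Real.log n := Real.log_natCast_nonneg n
  have hy : ∀ k < n, ∀ x, |x| ≤ B → |x - surrogateTarget B H G x₀ g i k| ≤ 2 * B + G / H := by
    intro k hk x hx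
    have hbox := learner_mem_box (H := H) (G := G) (g := g) hB.le hx₀ k
    have h1 := abs_le.1 (hbox i)
    have h2 : |g (k + 1) (learner B H G x₀ g (k + 1)) i / H| ≤ G / H := by
      rw [abs_div, abs_of_pos hH]
      have := hg (k + 1) (mem_Icc.2 ⟨by omega, by omega⟩) _ hbox i
      gcongr
    have h2 := abs_le.1 h2
    have h3 := abs_le.1 hx
    unfold surrogateTarget
    rw [abs_le]
    constructor <;> linarith
  refine dynamic_regret_of_adaptive_regret hB (by positivity) hε
    (fun k hk => hy k hk _ (learner_mem_box hB.le hx₀ k i)) (fun a b u hab hbn hu => ?_) hw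
  exact (isFLHRun_learnerState i).adaptive_regret_le hB.le (hx₀ i) hM rfl hy hu hab hbn

/-- The dynamic regret for every resolution `ε` of the rounding, the same in all coordinates. -/
lemma regret_le_of_resolution (hB : 0 < B) (hH : 0 < H) (hG : 0 ≤ G) {n : ℕ}
    {f : ℕ → EuclideanSpace ℝ (Fin d) → ℝ}
    (hf : ∀ t ∈ Icc 1 n, ∀ x ∈ box d B, ∀ y ∈ box d B,
      f t x + inner ℝ (g t x) (y - x) + H / 2 * ‖y - x‖ ^ 2 ≤ f t y)
    (hg : ∀ t ∈ Icc 1 n, ∀ x ∈ box d B, ∀ i, |g t x i| ≤ G) (hx₀ : ∀ i j, |x₀ i j| ≤ B)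
    {w : ℕ → EuclideanSpace ℝ (Fin d)} (hw : ∀ t ∈ Icc 1 n, w t ∈ box d B)
    {ε : ℝ} (hε : 0 < ε) :
    ∑ t ∈ Icc 1 n, (f t (learner B H G x₀ g t) - f t (w t)) ≤
      H / 2 * (3 * (2 * B + G / H) ^ 2 * (1 + Real.log n) * (totalVariation n w / ε + d) +
        (8 + (2 * B + G / H) ^ 2 / B ^ 2) * (d * n * ε ^ 2)) := by
  set R := 3 * (2 * B + G / H) ^ 2 * (1 + Real.log n) with hR
  set A := 8 + (2 * B + G / H) ^ 2 / B ^ 2 with hA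
  have h1 : ∀ k ∈ range n, f (k + 1) (learner B H G x₀ g (k + 1)) - f (k + 1) (w (k + 1)) ≤
      H / 2 * ∑ i, ((learner B H G x₀ g (k + 1) i - surrogateTarget B H G x₀ g i k) ^ 2 -
        (w (k + 1) i - surrogateTarget B H G x₀ g i k) ^ 2) := by
    intro k hk
    have hk' : k + 1 ∈ Icc 1 n := mem_Icc.2 ⟨by omega, by have := mem_range.1 hk; omega⟩
    exact sub_le_surrogate hH (hf _ hk' _ (learner_mem_box hB.le hx₀ k) _ (hw _ hk'))
  have h2 : ∀ i : Fin d, ∑ k ∈ range n,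
      ((learner B H G x₀ g (k + 1) i - surrogateTarget B H G x₀ g i k) ^ 2 -
        (w (k + 1) i - surrogateTarget B H G x₀ g i k) ^ 2) ≤
      R / ε * (∑ k ∈ range (n - 1), |w (k + 1 + 1) i - w (k + 1) i|) + R + A * n * ε ^ 2 :=
    fun i => surrogate_regret_le hB hH hG hx₀ hg i (w := fun k => w (k + 1) i)
      (fun k hk => hw (k + 1) (mem_Icc.2 ⟨by omega, by omega⟩) i) hε
  have hTV : totalVariation n w = ∑ i, ∑ k ∈ range (n - 1), |w (k + 1 + 1) i - w (k + 1) i| := by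
    unfold totalVariation
    rw [sum_Icc_succ_eq_sum_range 1 n, sum_comm]
    rfl
  calc ∑ t ∈ Icc 1 n, (f t (learner B H G x₀ g t) - f t (w t))
      = ∑ k ∈ range n, (f (k + 1) (learner B H G x₀ g (k + 1)) - f (k + 1) (w (k + 1))) :=
        sum_Icc_succ_eq_sum_range 0 n _
    _ ≤ H / 2 * ∑ i, ∑ k ∈ range n,
        ((learner B H G x₀ g (k + 1) i - surrogateTarget B H G x₀ g i k) ^ 2 -
          (w (k + 1) i - surrogateTarget B H G x₀ g i k) ^ 2) := by
        rw [sum_comm, mul_sum]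
        exact sum_le_sum h1
    _ ≤ H / 2 * ∑ i : Fin d,
        (R / ε * (∑ k ∈ range (n - 1), |w (k + 1 + 1) i - w (k + 1) i|) + R + A * n * ε ^ 2) := by
        gcongr with i
        exact h2 i
    _ = H / 2 * (R * (totalVariation n w / ε + d) + A * (d * n * ε ^ 2)) := by
        rw [sum_add_distrib, sum_add_distrib, ← mul_sum, ← hTV]
        simp only [sum_const, card_univ, Fintype.card_fin, nsmul_eq_mul]
        ring

end Learner

/-- A resolution that balances the two error terms. -/
lemma exists_resolution {C : ℝ} (hC : 0 ≤ C) {d n : ℕ} (hd : 0 < d) (hn : 0 < n) :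
    ∃ ε : ℝ, 0 < ε ∧
      C / ε ≤ (d : ℝ) ^ (1 / 3 : ℝ) * (n : ℝ) ^ (1 / 3 : ℝ) * C ^ (2 / 3 : ℝ) ∧
      d * n * ε ^ 2 ≤
        max ((d : ℝ) ^ (1 / 3 : ℝ) * (n : ℝ) ^ (1 / 3 : ℝ) * C ^ (2 / 3 : ℝ)) (d : ℝ) := by
  have hd' : (0 : ℝ) < d := Nat.cast_pos.2 hd
  have hn' : (0 : ℝ) < n := Nat.cast_pos.2 hn
  rcases hC.eq_or_lt with rfl | hC
  · refine ⟨1 / n, by positivity, ?_, le_max_of_le_right ?_⟩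
    · rw [zero_div]
      positivity
    · have h1 : (1 : ℝ) ≤ n := Nat.one_le_cast.2 hn
      calc d * n * (1 / (n : ℝ)) ^ 2 = d / n := by field_simp
        _ ≤ d := div_le_self hd'.le h1
  · -- in terms of the cube roots `α`, `β`, `γ` of `d`, `n`, `C` the choice is `γ / (α β)`
    have cube : ∀ x : ℝ, 0 < x → (x ^ (1 / 3 : ℝ)) ^ 3 = x := fun x hx => by
      rw [← Real.rpow_natCast, ← Real.rpow_mul hx.le]
      norm_num
    have hC2 : C ^ (2 / 3 : ℝ) = (C ^ (1 / 3 : ℝ)) ^ 2 := by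
      rw [← Real.rpow_natCast, ← Real.rpow_mul hC.le]
      norm_num
    have hα := cube d hd'
    have hβ := cube n hn'
    have hγ := cube C hC
    have hα0 := Real.rpow_pos_of_pos hd' (1 / 3)
    have hβ0 := Real.rpow_pos_of_pos hn' (1 / 3)
    have hγ0 := Real.rpow_pos_of_pos hC (1 / 3)
    rw [hC2]
    set α := (d : ℝ) ^ (1 / 3 : ℝ)
    set β := (n : ℝ) ^ (1 / 3 : ℝ)
    set γ := C ^ (1 / 3 : ℝ)
    refine ⟨γ / (α * β), by positivity, ?_, le_max_of_le_left ?_⟩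
    · rw [← hγ]
      apply le_of_eq
      field_simp
    · rw [← hα, ← hβ]
      apply le_of_eq
      field_simp

end

theorem mainTheorem2 :
    ∃ p : ℕ, ∀ B H G : ℝ, 0 < B → 0 < H → 0 ≤ G → ∃ K : ℝ, 0 < K ∧
      ∀ (d n : ℕ)
        (f : ℕ → EuclideanSpace ℝ (Fin d) → ℝ)
        (g : ℕ → EuclideanSpace ℝ (Fin d) → EuclideanSpace ℝ (Fin d))
        (x₀ : Fin d → ℕ → ℝ),
        (∀ t ∈ Finset.Icc 1 n, ∀ x ∈ box d B, ∀ y ∈ box d B,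
          f t x + inner ℝ (g t x) (y - x) + H / 2 * ‖y - x‖ ^ 2 ≤ f t y) →
        (∀ t ∈ Finset.Icc 1 n, ∀ x ∈ box d B, ∀ i, |g t x i| ≤ G) →
        (∀ i j, |x₀ i j| ≤ B) →
        (∀ t ∈ Finset.Icc 1 n, learner B H G x₀ g t ∈ box d B) ∧
        ∀ (C : ℝ) (w : ℕ → EuclideanSpace ℝ (Fin d)),
          (∀ t ∈ Finset.Icc 1 n, w t ∈ box d B) →
          totalVariation n w ≤ C →
          ∑ t ∈ Finset.Icc 1 n, (f t (learner B H G x₀ g t) - f t (w t)) ≤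
            K * (1 + Real.log n) ^ p *
              max ((d : ℝ) ^ (1 / 3 : ℝ) * (n : ℝ) ^ (1 / 3 : ℝ) * C ^ (2 / 3 : ℝ)) (d : ℝ) := by
  refine ⟨1, fun B H G hB hH hG =>
    ⟨H / 2 * (6 * (2 * B + G / H) ^ 2 + (8 + (2 * B + G / H) ^ 2 / B ^ 2)), by positivity,
      fun d n f g x₀ hf hg hx₀ => ⟨fun t ht => ?_, fun C w hw hC => ?_⟩⟩⟩
  · obtain ⟨k, rfl⟩ := Nat.exists_eq_add_of_le' (Finset.mem_Icc.1 ht).1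
    exact learner_mem_box hB.le hx₀ k
  have hC0 : 0 ≤ C := le_trans
    (Finset.sum_nonneg fun _ _ => Finset.sum_nonneg fun _ _ => abs_nonneg _) hC
  have hL : 1 ≤ 1 + Real.log n := by
    linarith [Real.log_natCast_nonneg n]
  rcases Nat.eq_zero_or_pos n with rfl | hn
  · simp only [Finset.Icc_eq_empty_of_lt zero_lt_one, Finset.sum_empty]
    positivity
  rcases Nat.eq_zero_or_pos d with rfl | hd
  · have h0 : ∀ t, w t = learner B H G x₀ g t := fun t => Subsingleton.elim _ _
    simp only [h0, sub_self, Finset.sum_const_zero]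
    positivity
  obtain ⟨ε, hε, h1, h2⟩ := exists_resolution hC0 hd hn
  refine (regret_le_of_resolution hB hH hG hf hg hx₀ hw hε).trans ?_
  set m := max ((d : ℝ) ^ (1 / 3 : ℝ) * (n : ℝ) ^ (1 / 3 : ℝ) * C ^ (2 / 3 : ℝ)) (d : ℝ)
  have h3 : totalVariation n w / ε + d ≤ 2 * m := by
    have h4 : totalVariation n w / ε ≤ C / ε := by gcongr
    have h5 : C / ε ≤ m := h1.trans (le_max_left _ _)
    have h6 : (d : ℝ) ≤ m := le_max_right _ _
    linarith
  have hm : 0 ≤ m := (Nat.cast_nonneg d).trans (le_max_right _ _)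
  calc H / 2 * (3 * (2 * B + G / H) ^ 2 * (1 + Real.log n) * (totalVariation n w / ε + d) +
        (8 + (2 * B + G / H) ^ 2 / B ^ 2) * (d * n * ε ^ 2))
      ≤ H / 2 * (3 * (2 * B + G / H) ^ 2 * (1 + Real.log n) * (2 * m) +
        (8 + (2 * B + G / H) ^ 2 / B ^ 2) * ((1 + Real.log n) * m)) := by
        gcongr H / 2 * (3 * (2 * B + G / H) ^ 2 * (1 + Real.log n) * ?_ + _ * ?_)
        exact h2.trans (le_mul_of_one_le_left hm hL)
    _ = H / 2 * (6 * (2 * B + G / H) ^ 2 + (8 + (2 * B + G / H) ^ 2 / B ^ 2)) *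
        (1 + Real.log n) ^ 1 * m := by ring
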